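/- **Theorem (Soundness of tableaux w.r.t. GS3).** Let $L$ be a first-order language without equality, with primitive $\neg,\wedge,\vee,\Rightarrow,\forall,\exists$, and let $L_{sk}$ be $L$ together with infinitely many Skolem function symbols of each arity. *Tableaux.* A free-variable tableau rooted at a set $\Gamma$ of $L_{sk}$-formulas is a finite tree whose root carries $\Gamma$, and in which each node carries all the formulas collected on its path and is extended by one of the following non-destructive rules, applied to a formula carried by the node. The $\alpha$-rules add all components: $A\wedge B$ gives $A,B$; $\neg(A\vee B)$ gives $\neg A,\neg B$; $\neg(A\Rightarrow B)$ gives $A,\neg B$; $\neg\neg A$ gives $A$. The $\beta$-rules branch: $A\vee B$ into $A\mid B$; $A\Rightarrow B$ into $\neg A\mid B$; $\neg(A\wedge B)$ into $\neg A\mid\neg B$. The $\gamma$-rules: $\forall x\,A$ gives $A(X)$ and $\neg\exists x\,A$ gives $\neg A(X)$, with $X$ a fresh free variable. The $\delta$-rules (inner Skolemization): $\exists x\,A$ gives $A(f(X_1,\dots,X_n))$ and $\neg\forall x\,A$ gives $\neg A(f(X_1,\dots,X_n))$, where $X_1,\dots,X_n$ are the distinct free variables of the quantified formula and $f$ is a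 fresh $n$-ary Skolem symbol. Fresh means new to the whole tableau, on all its branches. A leaf carrying $A$ and $\neg B$ may be closed under the constraint $A\approx B$. The tableau is closed with unifier $\sigma$ if all its leaves are closed and the substitution $\sigma$ satisfies $\sigma A=\sigma B$ for all its closure constraints $A\approx B$ simultaneously. *GS3.* Sequents $\Delta\vdash$ are sets of closed $L$-formulas. The rules, read from conclusion to premises, keep the principal formula (implicit contraction). The axioms are $\Delta,A,\neg A\vdash$; weakening derives $\Delta,A\vdash$ from $\Delta\vdash$; the $\alpha$- and $\beta$-rules add the components listed above; the $\gamma$-rules add $A(t)$ for $\forall x\,A$, or $\neg A(t)$ for $\neg\exists x\,A$, where $t$ is any closed $L$-term; the $\delta$-rules add $A(c)$ for $\exists x\,A$, or $\neg A(c)$ for $\neg\forall x\,A$, where $c$ is a constant of $L$ that does not occur in the conclusion. There is no cut rule. *Claim.* Let $\Gamma$ be the root of a closed tableau with unifier $\sigma$. If $\sigma$ leaves free variables in $\Gamma$, let $\sigma\Gamma$ stand for the ground instance $\kappa\sigma\Gamma$, where $\kappa$ maps free variables to constants of $L$. Suppose that $\sigma\Gamma$ contains no Skolem symbols (if the formulas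 of $\Gamma$ are closed $L$-formulas, then $\sigma\Gamma=\Gamma$ and this holds), and that infinitely many constants of $L$ do not occur in $\sigma\Gamma$. Then the sequent $\sigma\Gamma\vdash$ has a GS3 proof. -/

import Mathlib

open scoped FirstOrder

universe u v w w'

namespace FVTab

/-- First-order formulas without equality over the language `L`, with free variables named by `V`
and `n` bound variables in scope (de Bruijn levels, as in `FirstOrder.Language.BoundedFormula`).
All the connectives and both quantifiers are primitive. -/
inductive Fml (L : FirstOrder.Language.{u, v}) (V : Type w) : ℕ → Type (max u v w)
  | rel {n k : ℕ} (R : L.Relations k) (ts : Fin k → L.Term (V ⊕ Fin n)) : Fml L V n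
  | neg {n : ℕ} (A : Fml L V n) : Fml L V n
  | conj {n : ℕ} (A B : Fml L V n) : Fml L V n
  | disj {n : ℕ} (A B : Fml L V n) : Fml L V n
  | impl {n : ℕ} (A B : Fml L V n) : Fml L V n
  | all {n : ℕ} (A : Fml L V (n + 1)) : Fml L V n
  | ex {n : ℕ} (A : Fml L V (n + 1)) : Fml L V n

/-- The variables of a term. -/
def termVars {L : FirstOrder.Language.{u, v}} {α : Type w} : L.Term α → Set α
  | .var a => {a}
  | .func _ ts => ⋃ i, termVars (ts i)

/-- The function symbols (with their arities) occurring in a term; constants have arity `0`. -/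
def termSymbols {L : FirstOrder.Language.{u, v}} {α : Type w} : L.Term α → Set (Σ k, L.Functions k)
  | .var _ => ∅
  | .func f ts => insert ⟨_, f⟩ (⋃ i, termSymbols (ts i))

namespace Fml

variable {L : FirstOrder.Language.{u, v}} {V : Type w} {W : Type w'}

/-- The free variables of a formula. -/
def freeVars : {n : ℕ} → Fml L V n → Set V
  | _, rel _ ts => {X | ∃ i, Sum.inl X ∈ termVars (ts i)}
  | _, neg A => A.freeVars
  | _, conj A B => A.freeVars ∪ B.freeVars
  | _, disj A B => A.freeVars ∪ B.freeVars
  | _, impl A B => A.freeVars ∪ B.freeVars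
  | _, all A => A.freeVars
  | _, ex A => A.freeVars

/-- The function symbols (with their arities) occurring in a formula. -/
def symbols : {n : ℕ} → Fml L V n → Set (Σ k, L.Functions k)
  | _, rel _ ts => ⋃ i, termSymbols (ts i)
  | _, neg A => A.symbols
  | _, conj A B => A.symbols ∪ B.symbols
  | _, disj A B => A.symbols ∪ B.symbols
  | _, impl A B => A.symbols ∪ B.symbols
  | _, all A => A.symbols
  | _, ex A => A.symbols

/-- Extension of a substitution under a binder: the newly bound variable is left alone. -/
def lift {n m : ℕ} (f : V ⊕ Fin n → L.Term (W ⊕ Fin m)) :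
    V ⊕ Fin (n + 1) → L.Term (W ⊕ Fin (m + 1)) :=
  Sum.elim
    (fun X => (f (Sum.inl X)).relabel (Sum.map id Fin.castSucc))
    (Fin.snoc (α := fun _ => L.Term (W ⊕ Fin (m + 1)))
      (fun i => (f (Sum.inr i)).relabel (Sum.map id Fin.castSucc))
      (FirstOrder.Language.Term.var (Sum.inr (Fin.last m))))

/-- Simultaneous capture-avoiding substitution of terms for all the variables in scope. -/
def bind : {n m : ℕ} → (V ⊕ Fin n → L.Term (W ⊕ Fin m)) → Fml L V n → Fml L W m
  | _, _, f, rel R ts => rel R (fun i => (ts i).subst f)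
  | _, _, f, neg A => neg (bind f A)
  | _, _, f, conj A B => conj (bind f A) (bind f B)
  | _, _, f, disj A B => disj (bind f A) (bind f B)
  | _, _, f, impl A B => impl (bind f A) (bind f B)
  | _, _, f, all A => all (bind (lift f) A)
  | _, _, f, ex A => ex (bind (lift f) A)

/-- The formula obtained from `A` by substituting `σ X` for each free variable `X`. -/
def subst {n : ℕ} (σ : V → L.Term W) (A : Fml L V n) : Fml L W n :=
  A.bind (Sum.elim (fun X => (σ X).relabel Sum.inl) (fun i => FirstOrder.Language.Term.var (Sum.inr i)))

/-- The instance `A(t)` of the body `A(x)` of a quantified formula. -/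
def inst (A : Fml L V 1) (t : L.Term V) : Fml L V 0 :=
  A.bind (Sum.elim (fun X => FirstOrder.Language.Term.var (Sum.inl X)) (fun _ => t.relabel Sum.inl))

/-- Reading a formula in a larger language. -/
def onLang {L' : FirstOrder.Language.{u, v}} (φ : L →ᴸ L') : {n : ℕ} → Fml L V n → Fml L' V n
  | _, rel R ts => rel (φ.onRelation R) (fun i => φ.onTerm (ts i))
  | _, neg A => neg (A.onLang φ)
  | _, conj A B => conj (A.onLang φ) (B.onLang φ)
  | _, disj A B => disj (A.onLang φ) (B.onLang φ)
  | _, impl A B => impl (A.onLang φ) (B.onLang φ)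
  | _, all A => all (A.onLang φ)
  | _, ex A => ex (A.onLang φ)

end Fml

/-! ### The one-sided sequent calculus -/

/-- Closed formulas: there are no free variables. -/
abbrev Closed (L : FirstOrder.Language.{u, v}) := Fml L Empty 0

/-- `GS3 Δ`: the sequent `Δ ⊢` has a (cut-free) proof in the one-sided calculus GS3, whose
sequents are sets of closed formulas. In every logical rule the principal formula belongs to the
conclusion `Δ` and is kept in the premises (implicit contraction); weakening is explicit. -/
inductive GS3 {L : FirstOrder.Language.{u, v}} : Set (Closed L) → Prop
  | ax {Δ : Set (Closed L)} (A : Closed L) : A ∈ Δ → A.neg ∈ Δ → GS3 Δ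
  | weak {Δ : Set (Closed L)} (A : Closed L) : GS3 Δ → GS3 (insert A Δ)
  | negNeg {Δ : Set (Closed L)} (A : Closed L) :
      A.neg.neg ∈ Δ → GS3 (insert A Δ) → GS3 Δ
  | conj {Δ : Set (Closed L)} (A B : Closed L) :
      A.conj B ∈ Δ → GS3 (insert A (insert B Δ)) → GS3 Δ
  | negDisj {Δ : Set (Closed L)} (A B : Closed L) :
      (A.disj B).neg ∈ Δ → GS3 (insert A.neg (insert B.neg Δ)) → GS3 Δ
  | negImpl {Δ : Set (Closed L)} (A B : Closed L) :
      (A.impl B).neg ∈ Δ → GS3 (insert A (insert B.neg Δ)) → GS3 Δ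
  | disj {Δ : Set (Closed L)} (A B : Closed L) :
      A.disj B ∈ Δ → GS3 (insert A Δ) → GS3 (insert B Δ) → GS3 Δ
  | impl {Δ : Set (Closed L)} (A B : Closed L) :
      A.impl B ∈ Δ → GS3 (insert A.neg Δ) → GS3 (insert B Δ) → GS3 Δ
  | negConj {Δ : Set (Closed L)} (A B : Closed L) :
      (A.conj B).neg ∈ Δ → GS3 (insert A.neg Δ) → GS3 (insert B.neg Δ) → GS3 Δ
  | ex {Δ : Set (Closed L)} (A : Fml L Empty 1) (c : L.Constants) :
      A.ex ∈ Δ → (∀ B ∈ Δ, (⟨0, c⟩ : Σ k, L.Functions k) ∉ B.symbols) →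
      GS3 (insert (A.inst c.term) Δ) → GS3 Δ
  | negAll {Δ : Set (Closed L)} (A : Fml L Empty 1) (c : L.Constants) :
      A.all.neg ∈ Δ → (∀ B ∈ Δ, (⟨0, c⟩ : Σ k, L.Functions k) ∉ B.symbols) →
      GS3 (insert (A.inst c.term).neg Δ) → GS3 Δ
  | all {Δ : Set (Closed L)} (A : Fml L Empty 1) (t : L.Term Empty) :
      A.all ∈ Δ → GS3 (insert (A.inst t) Δ) → GS3 Δ
  | negEx {Δ : Set (Closed L)} (A : Fml L Empty 1) (t : L.Term Empty) :
      A.ex.neg ∈ Δ → GS3 (insert (A.inst t).neg Δ) → GS3 Δ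

/-! ### Free-variable tableaux -/

/-- The Skolem symbols: infinitely many function symbols of each arity. -/
def skolemLang : FirstOrder.Language.{u, v} := ⟨fun _ => ULift ℕ, fun _ => PEmpty⟩

/-- The language of tableaux over `L`: the symbols of `L` together with the Skolem symbols. -/
abbrev withSkolem (L : FirstOrder.Language.{u, v}) : FirstOrder.Language.{u, v} := L.sum skolemLang.{u, v}

/-- The `k`-th Skolem symbol of arity `n`. -/
def skolemSymbol (L : FirstOrder.Language.{u, v}) (n k : ℕ) : (withSkolem L).Functions n :=
  Sum.inr (ULift.up k)

/-- A closed formula of `L`, read as a formula of the language of tableaux. -/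
def Closed.embed {L : FirstOrder.Language.{u, v}} (V : Type w) (A : Closed L) : Fml (withSkolem L) V 0 :=
  (A.onLang (FirstOrder.Language.LHom.sumInl : L →ᴸ withSkolem L)).subst Empty.elim

section Tableaux

variable {L : FirstOrder.Language.{u, v}} {V : Type w}

/-- `Alpha A S`: `A` is a conjunctive formula with set of components `S`. -/
inductive Alpha : Fml L V 0 → Set (Fml L V 0) → Prop
  | conj (A B : Fml L V 0) : Alpha (A.conj B) {A, B}
  | negDisj (A B : Fml L V 0) : Alpha (A.disj B).neg {A.neg, B.neg}
  | negImpl (A B : Fml L V 0) : Alpha (A.impl B).neg {A, B.neg}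
  | negNeg (A : Fml L V 0) : Alpha A.neg.neg {A}

/-- `Beta A B C`: `A` is a disjunctive formula with components `B` and `C`. -/
inductive Beta : Fml L V 0 → Fml L V 0 → Fml L V 0 → Prop
  | disj (A B : Fml L V 0) : Beta (A.disj B) A B
  | impl (A B : Fml L V 0) : Beta (A.impl B) A.neg B
  | negConj (A B : Fml L V 0) : Beta (A.conj B).neg A.neg B.neg

/-- `Gamma A B`: `A` is a universal formula with body `B`. -/
inductive Gamma : Fml L V 0 → Fml L V 1 → Prop
  | all (B : Fml L V 1) : Gamma B.all B
  | negEx (B : Fml L V 1) : Gamma B.ex.neg B.neg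

/-- `Delta A B`: `A` is an existential formula with body `B`. -/
inductive Delta : Fml L V 0 → Fml L V 1 → Prop
  | ex (B : Fml L V 1) : Delta B.ex B
  | negAll (B : Fml L V 1) : Delta B.all.neg B.neg

/-- Tableau trees, indexed by the set of formulas at the root. Rules are non-destructive: each node
carries all the formulas collected on its path. Freshness and the unification constraints are
global conditions, stated below. -/
inductive Tableau : Set (Fml (withSkolem L) V 0) → Type (max u v w)
  | openLeaf (Δ : Set (Fml (withSkolem L) V 0)) : Tableau Δ
  /-- A leaf closed by `A` and `¬B`, under the constraint `A ≈ B`. -/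
  | closure {Δ : Set (Fml (withSkolem L) V 0)} (A B : Fml (withSkolem L) V 0)
      (hA : A ∈ Δ) (hB : B.neg ∈ Δ) : Tableau Δ
  | alpha {Δ : Set (Fml (withSkolem L) V 0)} (A : Fml (withSkolem L) V 0)
      (S : Set (Fml (withSkolem L) V 0)) (hA : A ∈ Δ) (h : Alpha A S)
      (T : Tableau (Δ ∪ S)) : Tableau Δ
  | beta {Δ : Set (Fml (withSkolem L) V 0)} (A B C : Fml (withSkolem L) V 0)
      (hA : A ∈ Δ) (h : Beta A B C)
      (T₀ : Tableau (insert B Δ)) (T₁ : Tableau (insert C Δ)) : Tableau Δ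
  /-- Instantiation of a universal formula by the free variable `X`. -/
  | gamma {Δ : Set (Fml (withSkolem L) V 0)} (A : Fml (withSkolem L) V 0)
      (B : Fml (withSkolem L) V 1) (hA : A ∈ Δ) (h : Gamma A B) (X : V)
      (T : Tableau (insert (B.inst (FirstOrder.Language.Term.var X)) Δ)) : Tableau Δ
  /-- Inner Skolemization with the `k`-th Skolem symbol of arity `n`: its arguments are exactly
  the free variables of the existential formula, each taken once. -/
  | delta {Δ : Set (Fml (withSkolem L) V 0)} (A : Fml (withSkolem L) V 0)
      (B : Fml (withSkolem L) V 1) (hA : A ∈ Δ) (h : Delta A B) (n k : ℕ) (args : Fin n → V)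
      (hinj : Function.Injective args) (hargs : Set.range args = A.freeVars)
      (T : Tableau (insert (B.inst
        (FirstOrder.Language.Term.func (skolemSymbol L n k) (fun i => FirstOrder.Language.Term.var (args i)))) Δ)) :
      Tableau Δ

namespace Tableau

/-- All branches are closed. -/
def IsClosed : {Δ : Set (Fml (withSkolem L) V 0)} → Tableau Δ → Prop
  | _, openLeaf _ => False
  | _, closure _ _ _ _ => True
  | _, alpha _ _ _ _ T => T.IsClosed
  | _, beta _ _ _ _ _ T₀ T₁ => T₀.IsClosed ∧ T₁.IsClosed
  | _, gamma _ _ _ _ _ T => T.IsClosed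
  | _, delta _ _ _ _ _ _ _ _ _ T => T.IsClosed

/-- The global constraint store: all the unification constraints of the closure rules. -/
def constraints : {Δ : Set (Fml (withSkolem L) V 0)} → Tableau Δ →
    Set (Fml (withSkolem L) V 0 × Fml (withSkolem L) V 0)
  | _, openLeaf _ => ∅
  | _, closure A B _ _ => {(A, B)}
  | _, alpha _ _ _ _ T => T.constraints
  | _, beta _ _ _ _ _ T₀ T₁ => T₀.constraints ∪ T₁.constraints
  | _, gamma _ _ _ _ _ T => T.constraints
  | _, delta _ _ _ _ _ _ _ _ _ T => T.constraints

/-- The free variables introduced by the γ-rules, one entry for each application. -/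
def gammaVars : {Δ : Set (Fml (withSkolem L) V 0)} → Tableau Δ → List V
  | _, openLeaf _ => []
  | _, closure _ _ _ _ => []
  | _, alpha _ _ _ _ T => T.gammaVars
  | _, beta _ _ _ _ _ T₀ T₁ => T₀.gammaVars ++ T₁.gammaVars
  | _, gamma _ _ _ _ X T => X :: T.gammaVars
  | _, delta _ _ _ _ _ _ _ _ _ T => T.gammaVars

/-- The Skolem symbols (with their arities) introduced by the δ-rules, one entry for each
application. -/
def skolems : {Δ : Set (Fml (withSkolem L) V 0)} → Tableau Δ →
    List (Σ n, (withSkolem L).Functions n)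
  | _, openLeaf _ => []
  | _, closure _ _ _ _ => []
  | _, alpha _ _ _ _ T => T.skolems
  | _, beta _ _ _ _ _ T₀ T₁ => T₀.skolems ++ T₁.skolems
  | _, gamma _ _ _ _ _ T => T.skolems
  | _, delta _ _ _ _ n k _ _ _ T => ⟨n, skolemSymbol L n k⟩ :: T.skolems

/-- Freshness: the free variables and the Skolem symbols introduced by the rules do not occur in
the root, and different applications introduce different ones. As a variable or a symbol that is
not in the root can only occur above the rule application that introduces it, this says that each
was new to the whole tableau when it was introduced, in whatever order the rules were applied. -/
structure Fresh {Γ : Set (Fml (withSkolem L) V 0)} (T : Tableau Γ) : Prop where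
  vars_nodup : T.gammaVars.Nodup
  vars_root : ∀ X ∈ T.gammaVars, ∀ A ∈ Γ, X ∉ A.freeVars
  skolems_nodup : T.skolems.Nodup
  skolems_root : ∀ s ∈ T.skolems, ∀ A ∈ Γ, s ∉ A.symbols

end Tableau

/-- `T` is a closed tableau with unifier `σ`: its rule applications respect freshness, all its
branches are closed, and `σ` solves all the constraints of the global store at once. -/
structure ClosedTableau {Γ : Set (Fml (withSkolem L) V 0)} (T : Tableau Γ)
    (σ : V → (withSkolem L).Term V) : Prop where
  fresh : T.Fresh
  closed : T.IsClosed
  unifier : ∀ p ∈ T.constraints, p.1.subst σ = p.2.subst σ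

/-- The ground instance `κ(σA)` of `A`, where `κ` turns the free variables left over by `σ` into
constants of `L`. It is just `σA` when `σA` is closed. -/
def groundInstance (σ : V → (withSkolem L).Term V) (κ : V → L.Constants)
    (A : Fml (withSkolem L) V 0) : Fml (withSkolem L) V 0 :=
  (A.subst σ).subst fun X =>
    (FirstOrder.Language.LHom.sumInl : L →ᴸ withSkolem L).onTerm (κ X).term

end Tableaux

end FVTab

/-! The proof is semantic: the tableau is not translated into a derivation. A closed tableau makes a
finite part of `σΓ` unsatisfiable, and GS3 without cut is complete for such sets.

Soundness (`Tableau.exists_refuting_structure`). A finite tableau uses only finitely many root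
formulas. Any structure can be modified on the Skolem symbols of the tableau so that every
assignment satisfying these formulas makes the left side of some closure constraint true and its
right side false. The new structure does not depend on the assignment: an inner Skolem function
takes as arguments all the free variables on which the choice of a witness depends. Reading each
variable `X` as the value of `κσX` turns truth of a formula into truth of its ground instance. As
`σ` equates both sides of every constraint, no structure satisfies the finite part
(`ClosedTableau.exists_finite_unsat`).

Completeness (`GS3.of_finite_unsat`). Suppose that `Γ' ⊢` has no proof. The whole of `Γ'`, possibly
uncountable, stays as a side context: a set is consistent when none of its finite subsets becomes
derivable together with `Γ'`. Only the finite part `Δ` has to be satisfied, so a countable family of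
formulas over countably many symbols suffices, with witnesses among the constants fresh for `Γ'`. A
maximal consistent, witnessed subset of this family is a Hintikka set: if a component required by a
rule were missing, maximality would make it refutable, and the rule would then refute a finite
subset. Neither a formula nor its negation need belong to the set, so cut is never called for. The
Herbrand structure of the Hintikka set satisfies `Δ`, a contradiction. -/

namespace FVTab

open FirstOrder Language Set

/-! ### Tarskian semantics, substitution and coincidence lemmas -/

section Semantics

variable {L : FirstOrder.Language.{u, v}} {V : Type w} {W : Type w'} {M : Type*}

/-- The value of a term in the structure `I`. -/
def val (I : L.Structure M) (v : V → M) (t : L.Term V) : M :=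
  @Term.realize L M I V v t

/-- Truth of a formula in the structure `I`. -/
def Fml.Sat (I : L.Structure M) (v : V → M) : {n : ℕ} → (Fin n → M) → Fml L V n → Prop
  | _, xs, rel R ts => I.RelMap R (fun i => val I (Sum.elim v xs) (ts i))
  | _, xs, neg A => ¬ A.Sat I v xs
  | _, xs, conj A B => A.Sat I v xs ∧ B.Sat I v xs
  | _, xs, disj A B => A.Sat I v xs ∨ B.Sat I v xs
  | _, xs, impl A B => A.Sat I v xs → B.Sat I v xs
  | _, xs, all A => ∀ a, A.Sat I v (Fin.snoc (α := fun _ => M) xs a)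
  | _, xs, ex A => ∃ a, A.Sat I v (Fin.snoc (α := fun _ => M) xs a)

/-- Truth of a formula without bound variables in scope. -/
abbrev Fml.Holds (I : L.Structure M) (v : V → M) (A : Fml L V 0) : Prop :=
  A.Sat I v Fin.elim0

theorem val_subst (I : L.Structure M) (v : W → M) (f : V → L.Term W) (t : L.Term V) :
    val I v (t.subst f) = val I (fun x => val I v (f x)) t :=
  letI := I
  Term.realize_subst

theorem val_relabel (I : L.Structure M) (v : W → M) (f : V → W) (t : L.Term V) :
    val I v (t.relabel f) = val I (v ∘ f) t :=
  letI := I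
  Term.realize_relabel

theorem Fml.sat_bind (I : L.Structure M) (v : W → M) {n m : ℕ} (A : Fml L V n)
    (f : V ⊕ Fin n → L.Term (W ⊕ Fin m)) (xs : Fin m → M) :
    (A.bind f).Sat I v xs ↔
      A.Sat I (fun X => val I (Sum.elim v xs) (f (.inl X)))
        (fun i => val I (Sum.elim v xs) (f (.inr i))) := by
  -- Evaluating the lifted substitution after binding `a` amounts to evaluating `f` first and then
  -- binding `a`; this carries the induction through both quantifiers.
  have hlift : ∀ {n m : ℕ} (f : V ⊕ Fin n → L.Term (W ⊕ Fin m)) (xs : Fin m → M) (a : M),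
      (fun X => val I (Sum.elim v (Fin.snoc (α := fun _ => M) xs a)) (lift f (.inl X))) =
          (fun X => val I (Sum.elim v xs) (f (.inl X))) ∧
        (fun i => val I (Sum.elim v (Fin.snoc (α := fun _ => M) xs a)) (lift f (.inr i))) =
          Fin.snoc (α := fun _ => M) (fun i => val I (Sum.elim v xs) (f (.inr i))) a := by
    intro n m f xs a
    have hs : Sum.elim v (Fin.snoc (α := fun _ => M) xs a) ∘ Sum.map id Fin.castSucc =
        Sum.elim v xs := by
      ext x
      cases x <;> simp
    refine ⟨?_, ?_⟩
    · ext X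
      simp only [lift, Sum.elim_inl, val_relabel, hs]
    · ext i
      refine Fin.lastCases ?_ (fun i => ?_) i
      · simp [lift, val]
      · simp only [lift, Sum.elim_inr, Fin.snoc_castSucc, val_relabel, hs]
  induction A generalizing m with
  | rel R ts =>
    simp only [bind, Sat, val_subst]
    refine iff_of_eq (congrArg _ (funext fun i => congrArg (fun e => val I e (ts i)) ?_))
    ext x
    cases x <;> rfl
  | neg A ih => simp only [bind, Sat, ih]
  | conj A B ihA ihB => simp only [bind, Sat, ihA, ihB]
  | disj A B ihA ihB => simp only [bind, Sat, ihA, ihB]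
  | impl A B ihA ihB => simp only [bind, Sat, ihA, ihB]
  | all A ih => simp only [bind, Sat, ih, hlift]
  | ex A ih => simp only [bind, Sat, ih, hlift]

theorem Fml.sat_subst (I : L.Structure M) (v : W → M) {n : ℕ} (A : Fml L V n)
    (σ : V → L.Term W) (xs : Fin n → M) :
    (A.subst σ).Sat I v xs ↔ A.Sat I (fun X => val I v (σ X)) xs := by
  rw [subst, sat_bind]
  refine iff_of_eq ?_
  congr 1
  ext X
  simp [val_relabel]

theorem Fml.holds_inst (I : L.Structure M) (v : V → M) (A : Fml L V 1) (t : L.Term V) :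
    (A.inst t).Holds I v ↔ A.Sat I v (fun _ => val I v t) := by
  rw [Holds, inst, sat_bind]
  simp [val_relabel]
  rfl

/-- Two structures have the same relations, and the same functions for the symbols in `S`. -/
structure AgreeOn (I J : L.Structure M) (S : Set (Σ k, L.Functions k)) : Prop where
  func : ∀ {k : ℕ} (f : L.Functions k), (⟨k, f⟩ : Σ k, L.Functions k) ∈ S →
    ∀ xs, I.funMap f xs = J.funMap f xs
  rel : ∀ {k : ℕ} (R : L.Relations k) xs, I.RelMap R xs ↔ J.RelMap R xs

theorem AgreeOn.refl (I : L.Structure M) (S : Set (Σ k, L.Functions k)) : AgreeOn I I S :=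
  ⟨fun _ _ _ => rfl, fun _ _ => Iff.rfl⟩

theorem AgreeOn.trans {I J K : L.Structure M} {S : Set (Σ k, L.Functions k)}
    (h : AgreeOn I J S) (h' : AgreeOn J K S) : AgreeOn I K S :=
  ⟨fun f hf xs => (h.func f hf xs).trans (h'.func f hf xs),
    fun R xs => (h.rel R xs).trans (h'.rel R xs)⟩

theorem AgreeOn.mono {I J : L.Structure M} {S S' : Set (Σ k, L.Functions k)}
    (h : AgreeOn I J S) (hS : S' ⊆ S) : AgreeOn I J S' :=
  ⟨fun f hf => h.func f (hS hf), h.rel⟩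

theorem val_congr {I J : L.Structure M} {v v' : V → M} (t : L.Term V)
    (h : AgreeOn I J (termSymbols t)) (hv : ∀ x ∈ termVars t, v x = v' x) :
    val I v t = val J v' t := by
  induction t with
  | var x => exact hv x rfl
  | func f ts ih =>
    have : (fun i => val I v (ts i)) = fun i => val J v' (ts i) := by
      ext i
      refine ih i (h.mono ?_) fun x hx => hv x ?_
      · exact (subset_iUnion (fun i => termSymbols (ts i)) i).trans (subset_insert _ _)
      · exact mem_iUnion.2 ⟨i, hx⟩
    exact (h.func f (mem_insert _ _) _).trans (congrArg (J.funMap f) this)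

/-- The coincidence lemma: it is what allows a fresh Skolem symbol to be reinterpreted without
disturbing formulas in which it does not occur. -/
theorem Fml.sat_congr {I J : L.Structure M} {v v' : V → M} {n : ℕ} (A : Fml L V n)
    (h : AgreeOn I J A.symbols) (hv : ∀ x ∈ A.freeVars, v x = v' x) (xs : Fin n → M) :
    A.Sat I v xs ↔ A.Sat J v' xs := by
  induction A with
  | rel R ts =>
    refine (h.rel R _).trans (iff_of_eq (congrArg _ (funext fun i => ?_)))
    refine val_congr _ (h.mono (subset_iUnion (fun i => termSymbols (ts i)) i)) ?_
    rintro (X | j) hX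
    · exact hv X ⟨i, hX⟩
    · rfl
  | neg A ih => exact not_congr (ih h hv xs)
  | conj A B ihA ihB =>
    exact and_congr (ihA (h.mono subset_union_left) (fun x hx => hv x (.inl hx)) xs)
      (ihB (h.mono subset_union_right) (fun x hx => hv x (.inr hx)) xs)
  | disj A B ihA ihB =>
    exact or_congr (ihA (h.mono subset_union_left) (fun x hx => hv x (.inl hx)) xs)
      (ihB (h.mono subset_union_right) (fun x hx => hv x (.inr hx)) xs)
  | impl A B ihA ihB =>
    exact imp_congr (ihA (h.mono subset_union_left) (fun x hx => hv x (.inl hx)) xs)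
      (ihB (h.mono subset_union_right) (fun x hx => hv x (.inr hx)) xs)
  | all A ih => exact forall_congr' fun a => ih h hv _
  | ex A ih => exact exists_congr fun a => ih h hv _

theorem Fml.sat_onLang {L' : FirstOrder.Language.{u, v}} (φ : L →ᴸ L') (I : L.Structure M)
    (J : L'.Structure M) (hf : ∀ {k : ℕ} (f : L.Functions k) xs,
      J.funMap (φ.onFunction f) xs = I.funMap f xs)
    (hR : ∀ {k : ℕ} (R : L.Relations k) xs, J.RelMap (φ.onRelation R) xs ↔ I.RelMap R xs)
    (v : V → M) {n : ℕ} (A : Fml L V n) (xs : Fin n → M) :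
    (A.onLang φ).Sat J v xs ↔ A.Sat I v xs := by
  have hval : ∀ {α : Type w} (e : α → M) (t : L.Term α), val J e (φ.onTerm t) = val I e t := by
    intro α e t
    induction t with
    | var x => rfl
    | func f ts ih =>
      exact (hf f _).trans (congrArg (I.funMap f) (funext ih))
  induction A with
  | rel R ts => simp only [onLang, Sat, hR, hval]
  | neg A ih => simp only [onLang, Sat, ih]
  | conj A B ihA ihB => simp only [onLang, Sat, ihA, ihB]
  | disj A B ihA ihB => simp only [onLang, Sat, ihA, ihB]
  | impl A B ihA ihB => simp only [onLang, Sat, ihA, ihB]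
  | all A ih => simp only [onLang, Sat, ih]
  | ex A ih => simp only [onLang, Sat, ih]

theorem Alpha.holds_iff {A : Fml L V 0} {S : Set (Fml L V 0)} (h : Alpha A S)
    (I : L.Structure M) (v : V → M) : A.Holds I v ↔ ∀ B ∈ S, B.Holds I v := by
  cases h <;> simp [Fml.Holds, Fml.Sat]

theorem Beta.holds_iff {A B C : Fml L V 0} (h : Beta A B C)
    (I : L.Structure M) (v : V → M) : A.Holds I v ↔ B.Holds I v ∨ C.Holds I v := by
  cases h <;> simp only [Fml.Holds, Fml.Sat] <;> tauto

theorem snoc_elim0 (a : M) :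
    Fin.snoc (α := fun _ => M) Fin.elim0 a = fun _ : Fin (0 + 1) => a := by
  ext i
  refine Fin.lastCases ?_ (fun i => i.elim0) i
  exact Fin.snoc_last (α := fun _ => M) _ _

theorem Gamma.holds_iff {A : Fml L V 0} {B : Fml L V 1} (h : Gamma A B)
    (I : L.Structure M) (v : V → M) : A.Holds I v ↔ ∀ a, B.Sat I v (fun _ => a) := by
  cases h <;> simp [Fml.Holds, Fml.Sat, snoc_elim0]

theorem Delta.holds_iff {A : Fml L V 0} {B : Fml L V 1} (h : Delta A B)
    (I : L.Structure M) (v : V → M) : A.Holds I v ↔ ∃ a, B.Sat I v (fun _ => a) := by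
  cases h <;> simp [Fml.Holds, Fml.Sat, snoc_elim0]

end Semantics

/-! ### Function symbols under substitution and tableau rules -/

section Symbols

variable {L : FirstOrder.Language.{u, v}} {V : Type w} {W : Type w'}

theorem termSymbols_relabel (f : V → W) (t : L.Term V) :
    termSymbols (t.relabel f) = termSymbols t := by
  induction t with
  | var x => rfl
  | func g ts ih => simp only [Term.relabel, termSymbols, ih]

theorem mem_termSymbols_subst {f : V → L.Term W} {t : L.Term V} {s : Σ k, L.Functions k}
    (hs : s ∈ termSymbols (t.subst f)) : s ∈ termSymbols t ∨ ∃ x, s ∈ termSymbols (f x) := by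
  induction t with
  | var x => exact .inr ⟨x, hs⟩
  | func g ts ih =>
    rcases hs with rfl | hs
    · exact .inl (mem_insert _ _)
    · obtain ⟨i, hi⟩ := mem_iUnion.1 hs
      exact (ih i hi).imp_left fun h => mem_insert_of_mem _ (mem_iUnion.2 ⟨i, h⟩)

theorem Fml.mem_symbols_bind {n m : ℕ} {f : V ⊕ Fin n → L.Term (W ⊕ Fin m)} {A : Fml L V n}
    {s : Σ k, L.Functions k} (hs : s ∈ (A.bind f).symbols) :
    s ∈ A.symbols ∨ ∃ x, s ∈ termSymbols (f x) := by
  have hlift : ∀ {n m : ℕ} (f : V ⊕ Fin n → L.Term (W ⊕ Fin m)),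
      (∃ x, s ∈ termSymbols (lift f x)) → ∃ x, s ∈ termSymbols (f x) := by
    rintro n m f ⟨X | i, hx⟩
    · rw [lift, Sum.elim_inl, termSymbols_relabel] at hx
      exact ⟨_, hx⟩
    · revert hx
      refine Fin.lastCases (fun hx => ?_) (fun i hx => ?_) i
      · rw [lift, Sum.elim_inr, Fin.snoc_last] at hx
        exact hx.elim
      · rw [lift, Sum.elim_inr, Fin.snoc_castSucc, termSymbols_relabel] at hx
        exact ⟨_, hx⟩
  induction A generalizing m with
  | rel R ts =>
    obtain ⟨i, hi⟩ := mem_iUnion.1 hs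
    exact (mem_termSymbols_subst hi).imp_left fun h => mem_iUnion.2 ⟨i, h⟩
  | neg A ih => exact ih hs
  | conj A B ihA ihB =>
    exact hs.elim (fun h => (ihA h).imp_left .inl) (fun h => (ihB h).imp_left .inr)
  | disj A B ihA ihB =>
    exact hs.elim (fun h => (ihA h).imp_left .inl) (fun h => (ihB h).imp_left .inr)
  | impl A B ihA ihB =>
    exact hs.elim (fun h => (ihA h).imp_left .inl) (fun h => (ihB h).imp_left .inr)
  | all A ih => exact (ih hs).imp_right (hlift f)
  | ex A ih => exact (ih hs).imp_right (hlift f)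

theorem Fml.mem_symbols_inst {A : Fml L V 1} {t : L.Term V} {s : Σ k, L.Functions k}
    (hs : s ∈ (A.inst t).symbols) : s ∈ A.symbols ∨ s ∈ termSymbols t := by
  refine (mem_symbols_bind hs).imp_right ?_
  rintro ⟨X | i, hx⟩
  · exact hx.elim
  · rwa [Sum.elim_inr, termSymbols_relabel] at hx

theorem Alpha.symbols_subset {A B : Fml L V 0} {S : Set (Fml L V 0)} (h : Alpha A S)
    (hB : B ∈ S) : B.symbols ⊆ A.symbols := by
  cases h <;> simp only [mem_insert_iff, mem_singleton_iff] at hB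
  all_goals first
    | subst hB
      exact subset_rfl
    | rcases hB with rfl | rfl
      exacts [subset_union_left, subset_union_right]

theorem Beta.symbols_eq {A B C : Fml L V 0} (h : Beta A B C) :
    A.symbols = B.symbols ∪ C.symbols := by
  cases h <;> rfl

theorem Gamma.symbols_eq {A : Fml L V 0} {B : Fml L V 1} (h : Gamma A B) :
    B.symbols = A.symbols := by
  cases h <;> rfl

theorem Delta.symbols_eq {A : Fml L V 0} {B : Fml L V 1} (h : Delta A B) :
    B.symbols = A.symbols := by
  cases h <;> rfl

theorem Delta.freeVars_eq {A : Fml L V 0} {B : Fml L V 1} (h : Delta A B) :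
    B.freeVars = A.freeVars := by
  cases h <;> rfl

/-- The function symbols occurring in a set of formulas. -/
def symbolsOf (Δ : Set (Fml L V 0)) : Set (Σ k, L.Functions k) := ⋃ A ∈ Δ, A.symbols

theorem symbols_subset_symbolsOf {Δ : Set (Fml L V 0)} {A : Fml L V 0} (hA : A ∈ Δ) :
    A.symbols ⊆ symbolsOf Δ :=
  subset_biUnion_of_mem (u := fun A : Fml L V 0 => A.symbols) hA

theorem symbolsOf_insert (A : Fml L V 0) (Δ : Set (Fml L V 0)) :
    symbolsOf (insert A Δ) = A.symbols ∪ symbolsOf Δ :=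
  biUnion_insert _ _ _

end Symbols

/-! ### Semantic soundness of tableaux with inner Skolemization -/

section Soundness

variable {L : FirstOrder.Language.{u, v}} {V : Type w} {M : Type*}

/-- Reinterpretation of one function symbol. -/
@[reducible]
noncomputable def updateFunc (I : L.Structure M) {n : ℕ} (f : L.Functions n)
    (F : (Fin n → M) → M) : L.Structure M := by
  classical
  exact
  { funMap := fun {m} g xs =>
      if h : (⟨n, f⟩ : Σ k, L.Functions k) = ⟨m, g⟩ then
        F (fun i => xs (Fin.cast (congrArg Sigma.fst h) i)) else I.funMap g xs
    RelMap := fun R xs => I.RelMap R xs }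

theorem updateFunc_self (I : L.Structure M) {n : ℕ} (f : L.Functions n)
    (F : (Fin n → M) → M) (xs : Fin n → M) : (updateFunc I f F).funMap f xs = F xs :=
  dif_pos rfl

theorem agreeOn_updateFunc (I : L.Structure M) {n : ℕ} (f : L.Functions n)
    (F : (Fin n → M) → M) : AgreeOn (updateFunc I f F) I {⟨n, f⟩}ᶜ :=
  ⟨fun _ hg _ => dif_neg fun h => hg h.symm, fun _ _ => Iff.rfl⟩

/-- The structure `I` can be modified on a Skolem symbol so that the corresponding instance of an
existential formula follows from that formula, for all values of the free variables. -/
theorem exists_skolem_structure [Nonempty M] (I : L.Structure M) {A : Fml L V 0}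
    {B : Fml L V 1} (h : Delta A B) {n : ℕ} (f : L.Functions n)
    (hf : (⟨n, f⟩ : Σ k, L.Functions k) ∉ A.symbols) (args : Fin n → V)
    (hinj : Function.Injective args) (hargs : range args = A.freeVars) :
    ∃ J : L.Structure M, AgreeOn J I {⟨n, f⟩}ᶜ ∧ ∀ v : V → M, A.Holds J v →
      (B.inst (.func f fun i => .var (args i))).Holds J v := by
  classical
  obtain ⟨d⟩ := ‹Nonempty M›
  -- The witness is chosen from the values of the arguments alone. All other variables get the
  -- default `d`, which is harmless because `args` enumerates every free variable of `A`.
  have hF : ∀ as : Fin n → M, ∃ a, (∃ a, B.Sat I (Function.extend args as fun _ => d)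
      (fun _ => a)) → B.Sat I (Function.extend args as fun _ => d) (fun _ => a) := by
    intro as
    by_cases hB : ∃ a, B.Sat I (Function.extend args as fun _ => d) (fun _ => a)
    · exact hB.imp fun a ha _ => ha
    · exact ⟨d, fun h => (hB h).elim⟩
  choose F hF using hF
  have hJ := agreeOn_updateFunc I f F
  refine ⟨updateFunc I f F, hJ, fun v hv => ?_⟩
  have hB : ∀ a, B.Sat (updateFunc I f F) v (fun _ => a) ↔
      B.Sat I (Function.extend args (fun i => v (args i)) fun _ => d) (fun _ => a) := by
    refine fun a => Fml.sat_congr B (hJ.mono ?_) ?_ _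
    · rw [h.symbols_eq]
      rintro s hs rfl
      exact hf hs
    · rw [h.freeVars_eq, ← hargs]
      rintro _ ⟨i, rfl⟩
      exact (hinj.extend_apply (fun i => v (args i)) (fun _ => d) i).symm
  rw [Fml.holds_inst]
  have hval : val (updateFunc I f F) v (.func f fun i => .var (args i)) =
      F fun i => v (args i) := updateFunc_self I f F _
  rw [hval, hB]
  rw [h.holds_iff] at hv
  exact hF _ (hv.imp fun a => (hB a).1)

/-- A closed tableau refutes a finite part of its root: after a suitable reinterpretation of the
Skolem symbols it introduces, any values of the free variables which satisfy this finite part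
also violate one of the closure constraints. -/
theorem Tableau.exists_refuting_structure {Γ : Set (Fml (withSkolem L) V 0)} (T : Tableau Γ)
    (hclosed : T.IsClosed) (hnodup : T.skolems.Nodup)
    (hroot : ∀ s ∈ T.skolems, s ∉ symbolsOf Γ) :
    ∃ Γ₀ ⊆ Γ, Γ₀.Finite ∧ ∀ (M : Type w') [Nonempty M] (I : (withSkolem L).Structure M),
      ∃ J : (withSkolem L).Structure M, AgreeOn J I {s | s ∉ T.skolems} ∧
        ∀ K : (withSkolem L).Structure M, AgreeOn K J (symbolsOf Γ ∪ {s | s ∈ T.skolems}) →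
          ∀ v : V → M, (∀ A ∈ Γ₀, A.Holds K v) →
            ∃ p ∈ T.constraints, p.1.Holds K v ∧ ¬ p.2.Holds K v := by
  induction T with
  | openLeaf Δ => exact hclosed.elim
  | @closure Δ A B hA hB =>
    refine ⟨{A, B.neg}, by simp [insert_subset_iff, hA, hB], toFinite _, fun M _ I =>
      ⟨I, AgreeOn.refl _ _, fun K _ v hv => ⟨(A, B), rfl, hv A (by simp), hv B.neg (by simp)⟩⟩⟩
  | @alpha Δ A S hA h T ih =>
    have hsub : symbolsOf (Δ ∪ S) ⊆ symbolsOf Δ := by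
      refine iUnion₂_subset fun B hB => ?_
      rcases hB with hB | hB
      · exact symbols_subset_symbolsOf hB
      · exact (h.symbols_subset hB).trans (symbols_subset_symbolsOf hA)
    obtain ⟨Γ₀, hΓ₀, hfin, H⟩ := ih hclosed hnodup fun s hs h => hroot s hs (hsub h)
    -- The components added by the rule are traded for the principal formula, which implies them.
    refine ⟨insert A (Γ₀ ∩ Δ), insert_subset hA inter_subset_right,
      (hfin.inter_of_left _).insert _, fun M _ I => ?_⟩
    obtain ⟨J, hJ, HJ⟩ := H M I
    refine ⟨J, hJ, fun K hK v hv => HJ K (hK.mono (union_subset_union_left _ hsub)) v ?_⟩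
    intro B hB
    rcases hΓ₀ hB with hB' | hB'
    · exact hv B (.inr ⟨hB, hB'⟩)
    · exact (h.holds_iff K v).1 (hv A (.inl rfl)) B hB'
  | @beta Δ A B C hA h T₀ T₁ ih₀ ih₁ =>
    obtain ⟨hnd₀, hnd₁, hdisj⟩ := List.nodup_append.1 hnodup
    have hsubB : symbolsOf (insert B Δ) ⊆ symbolsOf Δ := by
      rw [symbolsOf_insert]
      refine union_subset (Subset.trans ?_ (symbols_subset_symbolsOf hA)) subset_rfl
      exact h.symbols_eq ▸ subset_union_left
    have hsubC : symbolsOf (insert C Δ) ⊆ symbolsOf Δ := by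
      rw [symbolsOf_insert]
      refine union_subset (Subset.trans ?_ (symbols_subset_symbolsOf hA)) subset_rfl
      exact h.symbols_eq ▸ subset_union_right
    obtain ⟨Γ₀, hΓ₀, hfin₀, H₀⟩ := ih₀ hclosed.1 hnd₀ fun s hs h =>
      hroot s (List.mem_append_left _ hs) (hsubB h)
    obtain ⟨Γ₁, hΓ₁, hfin₁, H₁⟩ := ih₁ hclosed.2 hnd₁ fun s hs h =>
      hroot s (List.mem_append_right _ hs) (hsubC h)
    refine ⟨insert A ((Γ₀ ∪ Γ₁) ∩ Δ), insert_subset hA inter_subset_right,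
      ((hfin₀.union hfin₁).inter_of_left _).insert _, fun M _ I => ?_⟩
    obtain ⟨J₀, hJ₀, HJ₀⟩ := H₀ M I
    -- One structure must serve both branches, so the second modification starts from the result of
    -- the first.
    obtain ⟨J₁, hJ₁, HJ₁⟩ := H₁ M J₀
    refine ⟨J₁, ?_, fun K hK v hv => ?_⟩
    · refine (hJ₁.mono ?_).trans (hJ₀.mono ?_)
      · exact fun s hs h => hs (List.mem_append_right _ h)
      · exact fun s hs h => hs (List.mem_append_left _ h)
    rcases (h.holds_iff K v).1 (hv A (.inl rfl)) with hB | hC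
    -- The Skolem symbols of the right branch occur neither at the root nor among those of the left
    -- branch, so passing from `J₀` to `J₁` leaves the left branch untouched. Quantifying over all
    -- `K` in the induction hypothesis makes this usable.
    · have hK₀ : AgreeOn K J₀ (symbolsOf (insert B Δ) ∪ {s | s ∈ T₀.skolems}) := by
        refine (hK.mono ?_).trans (hJ₁.mono ?_)
        · exact union_subset_union hsubB fun s => List.mem_append_left _
        · rintro s (hs | hs) hs'
          · exact hroot s (List.mem_append_right _ hs') (hsubB hs)
          · exact hdisj s hs s hs' rfl
      obtain ⟨p, hp, hp'⟩ := HJ₀ K hK₀ v fun D hD => by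
        rcases hΓ₀ hD with rfl | hD'
        · exact hB
        · exact hv D (.inr ⟨.inl hD, hD'⟩)
      exact ⟨p, .inl hp, hp'⟩
    · have hK₁ : AgreeOn K J₁ (symbolsOf (insert C Δ) ∪ {s | s ∈ T₁.skolems}) :=
        hK.mono (union_subset_union hsubC fun s => List.mem_append_right _)
      obtain ⟨p, hp, hp'⟩ := HJ₁ K hK₁ v fun D hD => by
        rcases hΓ₁ hD with rfl | hD'
        · exact hC
        · exact hv D (.inr ⟨.inr hD, hD'⟩)
      exact ⟨p, .inr hp, hp'⟩
  | @gamma Δ A B hA h X T ih =>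
    have hsub : symbolsOf (insert (B.inst (.var X)) Δ) ⊆ symbolsOf Δ := by
      rw [symbolsOf_insert]
      refine union_subset (Subset.trans ?_ (symbols_subset_symbolsOf hA)) subset_rfl
      intro s hs
      exact (Fml.mem_symbols_inst hs).elim (fun h' => h.symbols_eq ▸ h') fun h' => h'.elim
    obtain ⟨Γ₀, hΓ₀, hfin, H⟩ := ih hclosed hnodup fun s hs h => hroot s hs (hsub h)
    refine ⟨insert A (Γ₀ ∩ Δ), insert_subset hA inter_subset_right,
      (hfin.inter_of_left _).insert _, fun M _ I => ?_⟩
    obtain ⟨J, hJ, HJ⟩ := H M I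
    refine ⟨J, hJ, fun K hK v hv => HJ K (hK.mono (union_subset_union_left _ hsub)) v ?_⟩
    intro D hD
    rcases hΓ₀ hD with rfl | hD'
    · rw [Fml.holds_inst]
      exact (h.holds_iff K v).1 (hv A (.inl rfl)) _
    · exact hv D (.inr ⟨hD, hD'⟩)
  | @delta Δ A B hA h n k args hinj hargs T ih =>
    obtain ⟨hk, hnd⟩ := List.nodup_cons.1 hnodup
    have hsub : symbolsOf (insert (B.inst (.func (skolemSymbol L n k)
        fun i => .var (args i))) Δ) ⊆ insert ⟨n, skolemSymbol L n k⟩ (symbolsOf Δ) := by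
      rw [symbolsOf_insert]
      refine union_subset ?_ (subset_insert _ _)
      intro s hs
      rcases Fml.mem_symbols_inst hs with h' | h'
      · exact .inr (symbols_subset_symbolsOf hA (h.symbols_eq ▸ h'))
      · simpa [termSymbols] using Or.inl (b := s ∈ symbolsOf Δ) (by simpa [termSymbols] using h')
    obtain ⟨Γ₀, hΓ₀, hfin, H⟩ := ih hclosed hnd fun s hs hs' => by
      rcases hsub hs' with rfl | hs'
      · exact hk hs
      · exact hroot s (List.mem_cons_of_mem _ hs) hs'
    refine ⟨insert A (Γ₀ ∩ Δ), insert_subset hA inter_subset_right,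
      (hfin.inter_of_left _).insert _, fun M _ I => ?_⟩
    have hkA : (⟨n, skolemSymbol L n k⟩ : Σ k, (withSkolem L).Functions k) ∉ A.symbols :=
      fun h' => hroot _ List.mem_cons_self (symbols_subset_symbolsOf hA h')
    -- The symbol of this step is interpreted before those of the subtree; the latter are distinct
    -- from it, so its interpretation survives.
    obtain ⟨I', hI', hA'⟩ := exists_skolem_structure I h (skolemSymbol L n k) hkA args hinj hargs
    obtain ⟨J, hJ, HJ⟩ := H M I'
    have hmem : {s | s ∈ (delta A B hA h n k args hinj hargs T).skolems} =
        insert ⟨n, skolemSymbol L n k⟩ {s | s ∈ T.skolems} := by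
      ext s
      exact List.mem_cons
    refine ⟨J, ?_, fun K hK v hv => HJ K (hK.mono ?_) v ?_⟩
    · refine (hJ.mono ?_).trans (hI'.mono ?_)
      · exact fun s hs h' => hs (List.mem_cons_of_mem _ h')
      · rintro s hs rfl
        exact hs List.mem_cons_self
    · rw [hmem]
      rintro s (hs | hs)
      · rcases hsub hs with rfl | hs
        · exact .inr (.inl rfl)
        · exact .inl hs
      · exact .inr (.inr hs)
    · have hKI : AgreeOn K I' (insert ⟨n, skolemSymbol L n k⟩ (symbolsOf Δ)) := by
        refine (hK.mono ?_).trans (hJ.mono ?_)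
        · rw [hmem]
          rintro s (rfl | hs)
          · exact .inr (.inl rfl)
          · exact .inl hs
        · rintro s (rfl | hs) hs'
          · exact hk hs'
          · exact hroot s (List.mem_cons_of_mem _ hs') hs
      intro D hD
      rcases hΓ₀ hD with rfl | hD'
      · refine (Fml.sat_congr _ (hKI.mono ?_) (fun _ _ => rfl) _).2 (hA' v ?_)
        · exact (symbols_subset_symbolsOf (mem_insert _ _)).trans hsub
        · refine (Fml.sat_congr A (hKI.mono ?_) (fun _ _ => rfl) _).1 (hv A (.inl rfl))
          exact (symbols_subset_symbolsOf hA).trans (subset_insert _ _)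
      · exact hv D (.inr ⟨hD, hD'⟩)

theorem Closed.holds_embed (I : L.Structure M) (J : (withSkolem L).Structure M)
    (hf : ∀ {k : ℕ} (f : L.Functions k) xs,
      J.funMap (Sum.inl f : (withSkolem L).Functions k) xs = I.funMap f xs)
    (hR : ∀ {k : ℕ} (R : L.Relations k) xs,
      J.RelMap (Sum.inl R : (withSkolem L).Relations k) xs ↔ I.RelMap R xs)
    (A : Closed L) (v : V → M) : (A.embed V).Holds J v ↔ A.Holds I Empty.elim := by
  rw [Fml.Holds, Closed.embed, Fml.sat_subst,
    Fml.sat_onLang (LHom.sumInl : L →ᴸ withSkolem L) I J hf hR,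
    Subsingleton.elim (fun X : Empty => val J v (Empty.elim X)) Empty.elim]

theorem Tableau.skolems_subset {Γ : Set (Fml (withSkolem L) V 0)} (T : Tableau Γ)
    {s : Σ n, (withSkolem L).Functions n} (hs : s ∈ T.skolems) :
    ∃ n k, s = ⟨n, skolemSymbol L n k⟩ := by
  induction T with
  | openLeaf Δ => simp [skolems] at hs
  | closure A B hA hB => simp [skolems] at hs
  | alpha A S hA h T ih => exact ih hs
  | beta A B C hA h T₀ T₁ ih₀ ih₁ => exact (List.mem_append.1 hs).elim ih₀ ih₁
  | gamma A B hA h X T ih => exact ih hs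
  | delta A B hA h n k args hinj hargs T ih =>
    exact (List.mem_cons.1 hs).elim (fun h => ⟨n, k, h⟩) ih

/-- Semantic soundness of tableaux: a finite part of the ground instance of the root of a closed
tableau is unsatisfiable. -/
theorem ClosedTableau.exists_finite_unsat {Γ : Set (Fml (withSkolem L) V 0)} {T : Tableau Γ}
    {σ : V → (withSkolem L).Term V} (hT : ClosedTableau T σ) (κ : V → L.Constants)
    {Γ' : Set (Closed L)} (hΓ' : groundInstance σ κ '' Γ = Closed.embed V '' Γ') :
    ∃ Δ ⊆ Γ', Δ.Finite ∧ ∀ (M : Type w') [Nonempty M] (I : L.Structure M),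
      ¬ ∀ A ∈ Δ, A.Holds I Empty.elim := by
  obtain ⟨Γ₀, hΓ₀, hfin, H⟩ := T.exists_refuting_structure hT.closed hT.fresh.skolems_nodup
    fun s hs h => by
      obtain ⟨A, hA, hsA⟩ := mem_iUnion₂.1 h
      exact hT.fresh.skolems_root s hs A hA hsA
  have hex : ∀ A ∈ Γ₀, ∃ B ∈ Γ', B.embed V = groundInstance σ κ A := fun A hA =>
    hΓ'.subset (mem_image_of_mem (groundInstance σ κ) (hΓ₀ hA))
  choose g hg hgA using hex
  have := hfin.to_subtype
  refine ⟨range fun A : Γ₀ => g A.1 A.2, range_subset_iff.2 fun A => hg A.1 A.2,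
    finite_range _, fun M _ I hI => ?_⟩
  obtain ⟨d⟩ := ‹Nonempty M›
  -- The Skolem symbols start with an arbitrary constant value; those that matter are reinterpreted
  -- in `J`.
  let I₀ : (withSkolem L).Structure M :=
    { funMap := fun f xs => Sum.elim (fun f => I.funMap f xs) (fun _ => d) f
      RelMap := fun R xs => Sum.elim (fun R => I.RelMap R xs) (fun _ => True) R }
  have : Nonempty M := ⟨d⟩
  obtain ⟨J, hJ, HJ⟩ := H M I₀
  let τ : V → (withSkolem L).Term V := fun X => (LHom.sumInl : L →ᴸ withSkolem L).onTerm (κ X).term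
  let e : V → M := fun X => val J (fun _ => d) (τ X)
  have hground : ∀ A : Fml (withSkolem L) V 0, (groundInstance σ κ A).Holds J (fun _ => d) ↔
      A.Holds J fun X => val J e (σ X) := by
    intro A
    rw [Fml.Holds, groundInstance, Fml.sat_subst, Fml.sat_subst]
  obtain ⟨p, hp, hp₁, hp₂⟩ := HJ J (AgreeOn.refl _ _) (fun X => val J e (σ X)) fun A hA => by
    rw [← hground, ← hgA A hA, Closed.holds_embed I J]
    · exact hI _ ⟨⟨A, hA⟩, rfl⟩
    · intro k f xs
      refine hJ.func _ ?_ xs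
      intro hs
      obtain ⟨n, j, h⟩ := T.skolems_subset hs
      obtain rfl : k = n := congrArg Sigma.fst h
      exact absurd (eq_of_heq (Sigma.mk.inj h).2) Sum.inl_ne_inr
    · exact fun R xs => hJ.rel _ xs
  -- Under this assignment `p.1` and `p.2` have the truth values of their `σ`-instances, which are
  -- the same formula.
  refine hp₂ ?_
  rw [Fml.Holds, ← Fml.sat_subst, ← hT.unifier p hp, Fml.sat_subst]
  exact hp₁

end Soundness

/-! ### GS3 in uniform notation -/

section Calculus

variable {L : FirstOrder.Language.{u, v}}

/-- Weakening adds one formula at a time, so it reaches finite sets only. Hence the completeness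
proof keeps `Γ` in every sequent and adds finite sets to it. -/
theorem GS3.weak_finite {Δ X : Set (Closed L)} (h : GS3 Δ) (hX : X.Finite) : GS3 (X ∪ Δ) := by
  induction X, hX using Set.Finite.induction_on with
  | empty => simpa using h
  | insert _ _ ih => simpa [insert_union] using ih.weak _

theorem GS3.alpha {Δ X : Set (Closed L)} {A : Closed L} (h : Alpha A X) (hA : A ∈ Δ)
    (hX : GS3 (X ∪ Δ)) : GS3 Δ := by
  cases h with
  | conj A B => exact .conj A B hA (by simpa [insert_union] using hX)
  | negDisj A B => exact .negDisj A B hA (by simpa [insert_union] using hX)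
  | negImpl A B => exact .negImpl A B hA (by simpa [insert_union] using hX)
  | negNeg A => exact .negNeg A hA (by simpa [insert_union] using hX)

theorem GS3.beta {Δ : Set (Closed L)} {A B C : Closed L} (h : Beta A B C) (hA : A ∈ Δ)
    (hB : GS3 (insert B Δ)) (hC : GS3 (insert C Δ)) : GS3 Δ := by
  cases h with
  | disj => exact .disj _ _ hA hB hC
  | impl => exact .impl _ _ hA hB hC
  | negConj => exact .negConj _ _ hA hB hC

theorem GS3.gamma {Δ : Set (Closed L)} {A : Closed L} {B : Fml L Empty 1} (h : Gamma A B)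
    (hA : A ∈ Δ) (t : L.Term Empty) (hB : GS3 (insert (B.inst t) Δ)) : GS3 Δ := by
  cases h with
  | all B => exact .all B t hA hB
  | negEx B => exact .negEx B t hA hB

theorem GS3.delta {Δ : Set (Closed L)} {A : Closed L} {B : Fml L Empty 1} (h : Delta A B)
    (hA : A ∈ Δ) (c : L.Constants) (hc : ∀ B ∈ Δ, (⟨0, c⟩ : Σ k, L.Functions k) ∉ B.symbols)
    (hB : GS3 (insert (B.inst c.term) Δ)) : GS3 Δ := by
  cases h with
  | ex B => exact .ex B c hA hc hB
  | negAll B => exact .negAll B c hA hc hB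

end Calculus

/-! ### Countable families closed under subformulas and negation -/

section Countability

variable {L : FirstOrder.Language.{u, v}} {V : Type w}

theorem termSymbols_finite (t : L.Term V) : (termSymbols t).Finite := by
  induction t with
  | var x => exact finite_empty
  | func f ts ih => exact (finite_iUnion ih).insert _

theorem Fml.symbols_finite {n : ℕ} (A : Fml L V n) : A.symbols.Finite := by
  induction A with
  | rel R ts => exact finite_iUnion fun i => termSymbols_finite _
  | neg A ih => exact ih
  | conj A B ihA ihB => exact ihA.union ihB
  | disj A B ihA ihB => exact ihA.union ihB
  | impl A B ihA ihB => exact ihA.union ihB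
  | all A ih => exact ih
  | ex A ih => exact ih

/-- The closed terms over the function symbols in `S`. -/
def termsOver (S : Set (Σ k, L.Functions k)) : Set (L.Term Empty) := {t | termSymbols t ⊆ S}

/-- These terms are the images of the closed terms of the sublanguage whose function symbols are
those in `S`, and a language with countably many function symbols has countably many closed terms.
-/
theorem termsOver_countable {S : Set (Σ k, L.Functions k)} (hS : S.Countable) :
    (termsOver S).Countable := by
  let L₀ : FirstOrder.Language.{u, v} :=
    ⟨fun k => {f : L.Functions k // (⟨k, f⟩ : Σ k, L.Functions k) ∈ S}, fun _ => PEmpty⟩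
  let φ : L₀ →ᴸ L := ⟨fun _ f => f.1, fun _ R => R.elim⟩
  have := hS.to_subtype
  have : Countable (Σ k, L₀.Functions k) := by
    refine Function.Injective.countable (β := S) (f := fun s => ⟨⟨s.1, s.2.1⟩, s.2.2⟩) ?_
    rintro ⟨k, f, hf⟩ ⟨l, g, hg⟩ h
    have h' := congrArg Subtype.val h
    cases h'
    rfl
  refine (countable_range (φ.onTerm (α := Empty))).mono ?_
  intro t ht
  induction t with
  | var x => exact x.elim
  | func f ts ih =>
    have hts : ∀ i, termSymbols (ts i) ⊆ S := fun i =>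
      ((subset_iUnion (fun i => termSymbols (ts i)) i).trans (subset_insert _ _)).trans ht
    choose us hus using fun i => ih i (hts i)
    exact ⟨.func (L := L₀) ⟨f, ht (mem_insert _ _)⟩ us, congrArg (Term.func f) (funext hus)⟩

/-- The negation and the immediate subformulas of a closed formula, the latter with the bound
variable replaced by a term in `D`. -/
def neighbours (D : Set (L.Term Empty)) (A : Closed L) : Set (Closed L) :=
  insert A.neg <| match A with
    | .rel _ _ => ∅
    | .neg A => {A}
    | .conj A B => {A, B}
    | .disj A B => {A, B}
    | .impl A B => {A, B}
    | .all A => A.inst '' D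
    | .ex A => A.inst '' D

theorem neighbours_countable {D : Set (L.Term Empty)} (hD : D.Countable) (A : Closed L) :
    (neighbours D A).Countable := by
  refine Countable.insert _ ?_
  cases A with
  | rel R ts => exact countable_empty
  | neg A => exact countable_singleton _
  | conj A B => exact (toFinite {A, B}).countable
  | disj A B => exact (toFinite {A, B}).countable
  | impl A B => exact (toFinite {A, B}).countable
  | all A => exact hD.image _
  | ex A => exact hD.image _

theorem mem_symbols_neighbours {S : Set (Σ k, L.Functions k)} {A B : Closed L}
    (hA : A.symbols ⊆ S) (hB : B ∈ neighbours (termsOver S) A) : B.symbols ⊆ S := by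
  have hinst : ∀ (C : Fml L Empty 1), C.symbols ⊆ S → B ∈ C.inst '' termsOver S →
      B.symbols ⊆ S := by
    rintro C hC ⟨t, ht, rfl⟩ s hs
    exact (Fml.mem_symbols_inst hs).elim (fun h => hC h) (fun h => ht h)
  rcases hB with rfl | hB
  · exact hA
  cases A with
  | rel R ts => exact hB.elim
  | neg A => exact hB ▸ hA
  | conj A C =>
    rcases hB with rfl | rfl
    exacts [subset_union_left.trans hA, subset_union_right.trans hA]
  | disj A C =>
    rcases hB with rfl | rfl
    exacts [subset_union_left.trans hA, subset_union_right.trans hA]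
  | impl A C =>
    rcases hB with rfl | rfl
    exacts [subset_union_left.trans hA, subset_union_right.trans hA]
  | all A => exact hinst A hA hB
  | ex A => exact hinst A hA hB

/-- Every countable set of closed formulas over `S` lies in a countable such set which is closed
under neighbours. -/
theorem exists_countable_closure {S : Set (Σ k, L.Functions k)} (hS : S.Countable)
    {Δ : Set (Closed L)} (hΔ : Δ.Countable) (hΔS : ∀ A ∈ Δ, A.symbols ⊆ S) :
    ∃ F : Set (Closed L), F.Countable ∧ Δ ⊆ F ∧ (∀ A ∈ F, A.symbols ⊆ S) ∧
      ∀ A ∈ F, neighbours (termsOver S) A ⊆ F := by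
  -- The stages need not increase: the neighbours of stage `n` make up stage `n + 1`, which is
  -- enough for the union to be closed.
  let G : ℕ → Set (Closed L) := fun n =>
    Nat.rec Δ (fun _ X => ⋃ A ∈ X, neighbours (termsOver S) A) n
  have hG : ∀ n, (G n).Countable ∧ ∀ A ∈ G n, A.symbols ⊆ S := by
    intro n
    induction n with
    | zero => exact ⟨hΔ, hΔS⟩
    | succ n ih =>
      refine ⟨ih.1.biUnion fun A _ => neighbours_countable (termsOver_countable hS) A, ?_⟩
      intro B hB
      obtain ⟨A, hA, hB⟩ := mem_iUnion₂.1 hB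
      exact mem_symbols_neighbours (ih.2 A hA) hB
  refine ⟨⋃ n, G n, countable_iUnion fun n => (hG n).1, subset_iUnion G 0, ?_, ?_⟩
  · intro A hA
    obtain ⟨n, hn⟩ := mem_iUnion.1 hA
    exact (hG n).2 A hn
  · intro A hA B hB
    obtain ⟨n, hn⟩ := mem_iUnion.1 hA
    exact mem_iUnion.2 ⟨n + 1, mem_iUnion₂.2 ⟨A, hn, hB⟩⟩

section Closure

variable {D : Set (L.Term Empty)} {F : Set (Closed L)} (hF : ∀ A ∈ F, neighbours D A ⊆ F)
include hF

/-- Components of a negated formula are reached inside `F` by removing the negation, passing to a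
subformula and, where needed, negating again. -/
theorem Alpha.subset_of_neighbours {A : Closed L} {X : Set (Closed L)} (h : Alpha A X)
    (hA : A ∈ F) : X ⊆ F := by
  have hneg : ∀ {B : Closed L}, B ∈ F → B.neg ∈ F := fun hB => hF _ hB (.inl rfl)
  have hpos : ∀ {B : Closed L}, B.neg ∈ F → B ∈ F := fun hB => hF _ hB (.inr rfl)
  cases h with
  | conj A B => exact fun C hC => hF _ hA (.inr hC)
  | negDisj A B =>
    rintro C (rfl | rfl)
    exacts [hneg (hF _ (hpos hA) (.inr (.inl rfl))), hneg (hF _ (hpos hA) (.inr (.inr rfl)))]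
  | negImpl A B =>
    rintro C (rfl | rfl)
    exacts [hF _ (hpos hA) (.inr (.inl rfl)), hneg (hF _ (hpos hA) (.inr (.inr rfl)))]
  | negNeg A =>
    rintro C rfl
    exact hpos (hpos hA)

theorem Beta.mem_of_neighbours {A B C : Closed L} (h : Beta A B C) (hA : A ∈ F) :
    B ∈ F ∧ C ∈ F := by
  have hneg : ∀ {B : Closed L}, B ∈ F → B.neg ∈ F := fun hB => hF _ hB (.inl rfl)
  have hpos : ∀ {B : Closed L}, B.neg ∈ F → B ∈ F := fun hB => hF _ hB (.inr rfl)
  cases h with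
  | disj A B => exact ⟨hF _ hA (.inr (.inl rfl)), hF _ hA (.inr (.inr rfl))⟩
  | impl A B => exact ⟨hneg (hF _ hA (.inr (.inl rfl))), hF _ hA (.inr (.inr rfl))⟩
  | negConj A B =>
    exact ⟨hneg (hF _ (hpos hA) (.inr (.inl rfl))), hneg (hF _ (hpos hA) (.inr (.inr rfl)))⟩

theorem Gamma.inst_mem_of_neighbours {A : Closed L} {B : Fml L Empty 1} (h : Gamma A B)
    (hA : A ∈ F) {t : L.Term Empty} (ht : t ∈ D) : B.inst t ∈ F := by
  cases h with
  | all B => exact hF _ hA (.inr ⟨t, ht, rfl⟩)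
  | negEx B => exact hF _ (hF _ (hF _ hA (.inr rfl)) (.inr ⟨t, ht, rfl⟩)) (.inl rfl)

theorem Delta.inst_mem_of_neighbours {A : Closed L} {B : Fml L Empty 1} (h : Delta A B)
    (hA : A ∈ F) {t : L.Term Empty} (ht : t ∈ D) : B.inst t ∈ F := by
  cases h with
  | ex B => exact hF _ hA (.inr ⟨t, ht, rfl⟩)
  | negAll B => exact hF _ (hF _ (hF _ hA (.inr rfl)) (.inr ⟨t, ht, rfl⟩)) (.inl rfl)

end Closure

end Countability

/-! ### Hintikka sets, Herbrand structures and completeness of GS3 -/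

section Completeness

variable {L : FirstOrder.Language.{u, v}}

theorem Delta.unique {A : Closed L} {B C : Fml L Empty 1} (h : Delta A B) (h' : Delta A C) :
    B = C := by
  cases h <;> cases h' <;> rfl

/-- One step of the construction of a Hintikka set: the formula `A` is added if this is consistent
with `S` and `Γ`, together with a witness if `A` is existential. -/
theorem exists_extension {Γ S : Set (Closed L)} {C : Set L.Constants} (hC : C.Infinite)
    (hfresh : ∀ c ∈ C, ∀ A ∈ Γ, (⟨0, c⟩ : Σ k, L.Functions k) ∉ A.symbols)
    (hfin : S.Finite) (hS : ¬ GS3 (S ∪ Γ)) (A : Closed L) :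
    ∃ S' : Set (Closed L), S ⊆ S' ∧ S'.Finite ∧ ¬ GS3 (S' ∪ Γ) ∧
      (∀ B ∈ S', B ∈ S ∨ B = A ∨ ∃ B', Delta A B' ∧ ∃ c ∈ C, B = B'.inst c.term) ∧
      (A ∈ S' ∨ GS3 (insert A (S ∪ Γ))) ∧
      (A ∈ S' → ∀ B, Delta A B → ∃ c ∈ C, B.inst c.term ∈ S') := by
  by_cases hA : GS3 (insert A (S ∪ Γ))
  · refine ⟨S, subset_rfl, hfin, hS, fun B hB => .inl hB, .inr hA, fun hAS => ?_⟩
    rw [insert_eq_of_mem (mem_union_left _ hAS)] at hA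
    exact (hS hA).elim
  by_cases hB : ∃ B, Delta A B
  · obtain ⟨B, hB⟩ := hB
    have hsym : (⋃ D ∈ insert A S, D.symbols).Finite :=
      (hfin.insert A).biUnion fun D _ => D.symbols_finite
    have hinj : Function.Injective fun c : L.Constants => (⟨0, c⟩ : Σ k, L.Functions k) :=
      sigma_mk_injective (β := L.Functions) (i := 0)
    -- Constants of `C` avoid `Γ`, and the finite set `insert A S` uses up only finitely many of
    -- them, so one is left that meets the eigenvariable condition.
    obtain ⟨c, hc, hcS⟩ := (hC.sdiff (hsym.preimage hinj.injOn)).nonempty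
    refine ⟨insert (B.inst c.term) (insert A S), ?_, (hfin.insert _).insert _, ?_, ?_,
      .inl (.inr (.inl rfl)), fun _ B' hB' => ⟨c, hc, .inl (by rw [hB.unique hB'])⟩⟩
    · exact (subset_insert _ _).trans (subset_insert _ _)
    · intro h
      rw [insert_union, insert_union] at h
      refine hA (GS3.delta hB (mem_insert _ _) c ?_ h)
      rintro D hD hcD
      rw [← insert_union] at hD
      rcases hD with hD | hD
      · exact hcS (mem_iUnion₂.2 ⟨D, hD, hcD⟩)
      · exact hfresh c hc D hD hcD
    · rintro D (rfl | rfl | hD)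
      exacts [.inr (.inr ⟨B, hB, c, hc, rfl⟩), .inr (.inl rfl), .inl hD]
  · refine ⟨insert A S, subset_insert _ _, hfin.insert _, by rwa [insert_union], ?_,
      .inl (.inl rfl), fun _ B hB' => (hB ⟨B, hB'⟩).elim⟩
    rintro D (rfl | hD)
    exacts [.inr (.inl rfl), .inl hD]

/-- Extension of a finite part of a non-derivable set to a maximal consistent and witnessed subset
of a countable set `F`. -/
theorem exists_maximal_consistent {Γ Δ F : Set (Closed L)} {C : Set L.Constants}
    (hC : C.Infinite)
    (hfresh : ∀ c ∈ C, ∀ A ∈ Γ, (⟨0, c⟩ : Σ k, L.Functions k) ∉ A.symbols)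
    (hΓ : ¬ GS3 Γ) (hΔ : Δ ⊆ Γ) (hfin : Δ.Finite) (hF : F.Countable) (hΔF : Δ ⊆ F)
    (hFC : ∀ A ∈ F, ∀ B, Delta A B → ∀ c ∈ C, B.inst c.term ∈ F) :
    ∃ H ⊆ F, Δ ⊆ H ∧ (∀ S ⊆ H, S.Finite → ¬ GS3 (S ∪ Γ)) ∧
      (∀ A ∈ F, A ∉ H → ∃ S ⊆ H, S.Finite ∧ GS3 (insert A (S ∪ Γ))) ∧
      ∀ A ∈ H, ∀ B, Delta A B → ∃ c ∈ C, B.inst c.term ∈ H := by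
  rcases F.eq_empty_or_nonempty with rfl | hne
  · refine ⟨∅, subset_rfl, hΔF, fun S hS _ => ?_, fun A hA => hA.elim, fun A hA => hA.elim⟩
    rwa [subset_empty_iff.1 hS, empty_union]
  obtain ⟨e, rfl⟩ := hF.exists_eq_range hne
  choose! next hsub hnfin hcons hnew hmax hwit using
    fun (S : Set (Closed L)) (hS : S.Finite ∧ ¬ GS3 (S ∪ Γ)) =>
      exists_extension hC hfresh hS.1 hS.2
  let s : ℕ → Set (Closed L) := fun n => Nat.rec Δ (fun n S => next S (e n)) n
  have hs : ∀ n, (s n).Finite ∧ ¬ GS3 (s n ∪ Γ) := by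
    intro n
    induction n with
    | zero => exact ⟨hfin, (union_eq_self_of_subset_left hΔ).symm ▸ hΓ⟩
    | succ n ih => exact ⟨hnfin _ ih _, hcons _ ih _⟩
  have hmono : Monotone s := monotone_nat_of_le_succ fun n => hsub _ (hs n) _
  have hsF : ∀ n, s n ⊆ range e := by
    intro n
    induction n with
    | zero => exact hΔF
    | succ n ih =>
      intro B hB
      rcases hnew _ (hs n) _ B hB with hB | rfl | ⟨B', hB', c, hc, rfl⟩
      · exact ih hB
      · exact mem_range_self n
      · exact hFC _ (mem_range_self n) B' hB' c hc
  refine ⟨⋃ n, s n, iUnion_subset hsF, subset_iUnion s 0, fun S hS hSfin hder => ?_, ?_, ?_⟩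
  · have hex : ∃ n, S ⊆ s n := by
      clear hder
      induction S, hSfin using Set.Finite.induction_on with
      | empty => exact ⟨0, empty_subset _⟩
      | @insert A S _ _ ih =>
        obtain ⟨n, hn⟩ := ih ((subset_insert _ _).trans hS)
        obtain ⟨m, hm⟩ := mem_iUnion.1 (hS (mem_insert _ _))
        exact ⟨max m n, insert_subset (hmono (le_max_left _ _) hm)
          (hn.trans (hmono (le_max_right _ _)))⟩
    obtain ⟨n, hn⟩ := hex
    have h := hder.weak_finite (hs n).1
    rw [← union_assoc, union_eq_self_of_subset_right hn] at h
    exact (hs n).2 h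
  · rintro _ ⟨n, rfl⟩ hnH
    refine ⟨s n, subset_iUnion s n, (hs n).1, (hmax _ (hs n) (e n)).resolve_left fun h => ?_⟩
    exact hnH (mem_iUnion.2 ⟨n + 1, h⟩)
  · intro A hA B hB
    obtain ⟨m, hm⟩ := mem_iUnion.1 hA
    obtain ⟨n, rfl⟩ := hsF m hm
    -- The formula may have entered at a stage `m` other than its own turn `n`. Had it been refused
    -- at its turn, its refutation would weaken to stage `max m n`, which already contains it.
    have hn : e n ∈ s (n + 1) := by
      refine (hmax _ (hs n) (e n)).resolve_right fun hder => ?_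
      have h := hder.weak_finite (hs (max m n)).1
      rw [union_insert, ← union_assoc,
        union_eq_self_of_subset_right (hmono (le_max_right m n)),
        insert_eq_of_mem (mem_union_left _ (hmono (le_max_left m n) hm))] at h
      exact (hs _).2 h
    obtain ⟨c, hc, h⟩ := hwit _ (hs n) (e n) hn B hB
    exact ⟨c, hc, mem_iUnion.2 ⟨n + 1, h⟩⟩

/-- Hintikka sets with respect to the terms in `D`. -/
structure Hintikka (D : Set (L.Term Empty)) (H : Set (Closed L)) : Prop where
  rel : ∀ {k : ℕ} (R : L.Relations k) ts, Fml.rel R ts ∈ H → (Fml.rel R ts).neg ∉ H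
  alpha : ∀ A ∈ H, ∀ X, Alpha A X → X ⊆ H
  beta : ∀ A ∈ H, ∀ B C, Beta A B C → B ∈ H ∨ C ∈ H
  gamma : ∀ A ∈ H, ∀ B, Gamma A B → ∀ t ∈ D, B.inst t ∈ H
  delta : ∀ A ∈ H, ∀ B, Delta A B → ∃ t ∈ D, B.inst t ∈ H

/-- A finite part of a non-derivable set, over the symbols in `S`, lies in a Hintikka set. -/
theorem exists_hintikka {Γ Δ : Set (Closed L)} {C : Set L.Constants}
    {S : Set (Σ k, L.Functions k)} (hC : C.Infinite)
    (hfresh : ∀ c ∈ C, ∀ A ∈ Γ, (⟨0, c⟩ : Σ k, L.Functions k) ∉ A.symbols)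
    (hΓ : ¬ GS3 Γ) (hΔ : Δ ⊆ Γ) (hfin : Δ.Finite) (hS : S.Countable)
    (hΔS : ∀ A ∈ Δ, A.symbols ⊆ S)
    (hCS : ∀ c ∈ C, (⟨0, c⟩ : Σ k, L.Functions k) ∈ S) :
    ∃ H, Δ ⊆ H ∧ (∀ A ∈ H, A.symbols ⊆ S) ∧ Hintikka (termsOver S) H := by
  obtain ⟨F, hF, hΔF, hFS, hFn⟩ := exists_countable_closure hS hfin.countable hΔS
  have hCterm : ∀ c ∈ C, (Constants.term c : L.Term Empty) ∈ termsOver S := by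
    rintro c hc s (rfl | hs)
    · exact hCS c hc
    · obtain ⟨i, -⟩ := mem_iUnion.1 hs
      exact i.elim0
  obtain ⟨H, hHF, hΔH, hcons, hmax, hwit⟩ := exists_maximal_consistent hC hfresh hΓ hΔ hfin hF hΔF
    fun A hA B hB c hc => hB.inst_mem_of_neighbours hFn hA (hCterm c hc)
  have hweak : ∀ {B : Closed L} {T T' : Set (Closed L)}, T ⊆ T' → T'.Finite →
      GS3 (insert B (T ∪ Γ)) → GS3 (insert B (T' ∪ Γ)) := by
    intro B T T' hT hT' h
    have h' := h.weak_finite hT'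
    rwa [union_insert, ← union_assoc, union_eq_self_of_subset_right hT] at h'
  refine ⟨H, hΔH, fun A hA => hFS A (hHF hA), ?_, ?_, ?_, ?_, ?_⟩
  · intro k R ts h h'
    exact hcons {.rel R ts, (Fml.rel R ts).neg} (by simp [insert_subset_iff, h, h'])
      (toFinite _) (.ax (.rel R ts) (by simp) (by simp))
  · intro A hA X hX B hB
    by_contra hBH
    obtain ⟨T, hT, hTfin, hder⟩ := hmax B (hX.subset_of_neighbours hFn (hHF hA) hB) hBH
    have hXfin : X.Finite := by
      cases hX <;> exact toFinite _
    refine hcons (insert A T) (insert_subset hA hT) (hTfin.insert A) ?_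
    -- A single missing component is refutable; the other components come in by weakening before the
    -- rule is applied.
    have h := (hweak (subset_insert A T) (hTfin.insert A) hder).weak_finite hXfin
    rw [union_insert, insert_eq_of_mem (mem_union_left _ hB)] at h
    exact GS3.alpha hX (by simp) h
  · intro A hA B B' hB
    by_contra! hBH
    obtain ⟨hBF, hBF'⟩ := hB.mem_of_neighbours hFn (hHF hA)
    obtain ⟨T, hT, hTfin, hder⟩ := hmax B hBF hBH.1
    obtain ⟨T', hT', hTfin', hder'⟩ := hmax B' hBF' hBH.2
    have hU : (insert A (T ∪ T')).Finite := (hTfin.union hTfin').insert A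
    refine hcons _ (insert_subset hA (union_subset hT hT')) hU
      (GS3.beta hB (by simp) (hweak ?_ hU hder) (hweak ?_ hU hder'))
    · exact subset_union_left.trans (subset_insert _ _)
    · exact subset_union_right.trans (subset_insert _ _)
  · intro A hA B hB t ht
    by_contra hBH
    obtain ⟨T, hT, hTfin, hder⟩ := hmax _ (hB.inst_mem_of_neighbours hFn (hHF hA) ht) hBH
    exact hcons _ (insert_subset hA hT) (hTfin.insert A)
      (GS3.gamma hB (by simp) t (hweak (subset_insert A T) (hTfin.insert A) hder))
  · intro A hA B hB
    obtain ⟨c, hc, h⟩ := hwit A hA B hB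
    exact ⟨c.term, hCterm c hc, h⟩

/-- The Herbrand structure over the closed terms with symbols in `S`, where the true atoms are
those in `H`. The symbols outside `S` are given the constant value `d`. -/
@[reducible]
noncomputable def herbrand (S : Set (Σ k, L.Functions k)) (H : Set (Closed L))
    (d : termsOver S) : L.Structure (termsOver S) := by
  classical
  exact
  { funMap := fun {k} f ts =>
      if h : (⟨k, f⟩ : Σ k, L.Functions k) ∈ S then
        ⟨.func f fun i => (ts i).1, insert_subset h (iUnion_subset fun i => (ts i).2)⟩
      else d
    RelMap := fun R ts => Fml.rel R (fun i => (ts i).1.relabel Sum.inl) ∈ H }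

theorem val_herbrand {S : Set (Σ k, L.Functions k)} (H : Set (Closed L)) (d : termsOver S)
    {α : Type} (e : α → termsOver S) (t : L.Term α) (ht : termSymbols t ⊆ S) :
    (val (herbrand S H d) e t).1 = t.subst fun x => (e x).1 := by
  induction t with
  | var x => rfl
  | func f ts ih =>
    refine (congrArg Subtype.val (dif_pos (ht (mem_insert _ _)))).trans ?_
    refine congrArg (Term.func f) (funext fun i => ih i ?_)
    exact ((subset_iUnion (fun i => termSymbols (ts i)) i).trans (subset_insert _ _)).trans ht

/-- Elements of the Herbrand universe and arguments of closed atoms are closed terms over different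
empty variable types; this makes the passage between them the identity. -/
theorem relabel_subst_of_isEmpty {α : Type*} {β : Type*} [IsEmpty α] (g : β → α)
    (e : α → L.Term β) (t : L.Term α) : (t.subst e).relabel g = t := by
  induction t with
  | var x => exact isEmptyElim x
  | func f ts ih => exact congrArg (Term.func f) (funext ih)

/-- A measure of formulas for which the components of a formula are smaller. -/
def Fml.size {V : Type w} : {n : ℕ} → Fml L V n → ℕ
  | _, rel _ _ => 1
  | _, neg A => A.size + 1
  | _, conj A B => A.size + B.size + 1
  | _, disj A B => A.size + B.size + 1
  | _, impl A B => A.size + B.size + 1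
  | _, all A => A.size + 1
  | _, ex A => A.size + 1

theorem Fml.size_pos {V : Type w} {n : ℕ} (A : Fml L V n) : 0 < A.size := by
  cases A <;> simp [size]

/-- Makes an instance smaller than its quantified formula, although it is not a structural subterm;
the truth lemma therefore goes by induction on size. -/
theorem Fml.size_bind {V : Type w} {W : Type w'} {n m : ℕ} (A : Fml L V n)
    (f : V ⊕ Fin n → L.Term (W ⊕ Fin m)) : (A.bind f).size = A.size := by
  induction A generalizing m with
  | rel R ts => rfl
  | neg A ih => simp only [bind, size, ih]
  | conj A B ihA ihB => simp only [bind, size, ihA, ihB]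
  | disj A B ihA ihB => simp only [bind, size, ihA, ihB]
  | impl A B ihA ihB => simp only [bind, size, ihA, ihB]
  | all A ih => simp only [bind, size, ih]
  | ex A ih => simp only [bind, size, ih]

/-- The Herbrand structure of a Hintikka set is a model of it. -/
theorem Hintikka.holds {S : Set (Σ k, L.Functions k)} {H : Set (Closed L)}
    (hH : Hintikka (termsOver S) H) (hS : ∀ A ∈ H, A.symbols ⊆ S) (d : termsOver S)
    {A : Closed L} (hA : A ∈ H) : A.Holds (herbrand S H d) Empty.elim := by
  have hrel : ∀ {k : ℕ} (R : L.Relations k) (ts : Fin k → L.Term (Empty ⊕ Fin 0)),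
      (Fml.rel R ts).symbols ⊆ S →
        ((Fml.rel R ts).Holds (herbrand S H d) Empty.elim ↔ Fml.rel R ts ∈ H) := by
    intro k R ts hts
    have : (fun i => (val (herbrand S H d) (Sum.elim Empty.elim Fin.elim0) (ts i)).1.relabel
        (Sum.inl : Empty → Empty ⊕ Fin 0)) = ts := by
      ext1 i
      rw [val_herbrand, relabel_subst_of_isEmpty]
      exact (subset_iUnion (fun i => termSymbols (ts i)) i).trans hts
    exact iff_of_eq (congrArg (fun us => Fml.rel R us ∈ H) this)
  have hval : ∀ t : termsOver S, val (herbrand S H d) Empty.elim t.1 = t := by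
    intro t
    refine Subtype.ext ((val_herbrand H d _ _ t.2).trans ?_)
    have h := relabel_subst_of_isEmpty (id : Empty → Empty)
      (fun x => (Empty.elim x : termsOver S).1) t.1
    rwa [Term.relabel_id] at h
  induction hn : A.size using Nat.strong_induction_on generalizing A with
  | _ n ih =>
  subst hn
  have hα : ∀ X, Alpha A X → A.Holds (herbrand S H d) Empty.elim := by
    refine fun X hX => (hX.holds_iff _ _).2 fun B hB => ih _ ?_ (hH.alpha A hA X hX hB) rfl
    cases hX <;> simp only [mem_insert_iff, mem_singleton_iff] at hB
    case negNeg => subst hB; simp only [Fml.size]; omega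
    all_goals
      rename_i B₁ B₂
      have h₁ := B₁.size_pos
      have h₂ := B₂.size_pos
      rcases hB with rfl | rfl <;> simp only [Fml.size] <;> omega
  have hβ : ∀ B C, Beta A B C → A.Holds (herbrand S H d) Empty.elim := by
    intro B C h
    have hsize : B.size < A.size ∧ C.size < A.size := by
      have hB := B.size_pos
      have hC := C.size_pos
      cases h <;> simp only [Fml.size] at * <;> omega
    exact (h.holds_iff _ _).2
      ((hH.beta A hA B C h).imp (fun hB => ih _ hsize.1 hB rfl) fun hC => ih _ hsize.2 hC rfl)
  have hγ : ∀ B, Gamma A B → A.Holds (herbrand S H d) Empty.elim := by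
    refine fun B h => (h.holds_iff _ _).2 fun t => ?_
    have := ih _ ?_ (hH.gamma A hA B h t.1 t.2) rfl
    · rwa [Fml.holds_inst, hval] at this
    · rw [Fml.inst, Fml.size_bind]
      cases h <;> simp only [Fml.size] <;> omega
  have hδ : ∀ B, Delta A B → A.Holds (herbrand S H d) Empty.elim := by
    intro B h
    obtain ⟨t, ht, hB⟩ := hH.delta A hA B h
    refine (h.holds_iff _ _).2 ⟨⟨t, ht⟩, ?_⟩
    have := ih _ ?_ hB rfl
    · rwa [Fml.holds_inst, hval ⟨t, ht⟩] at this
    · rw [Fml.inst, Fml.size_bind]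
      cases h <;> simp only [Fml.size] <;> omega
  cases A with
  | rel R ts => exact (hrel R ts (hS _ hA)).2 hA
  | conj A B => exact hα _ (.conj A B)
  | disj A B => exact hβ _ _ (.disj A B)
  | impl A B => exact hβ _ _ (.impl A B)
  | all A => exact hγ _ (.all A)
  | ex A => exact hδ _ (.ex A)
  | neg A =>
    cases A with
    | rel R ts =>
      have hsym : (Fml.rel R ts).symbols ⊆ S := hS (Fml.rel R ts).neg hA
      -- The only place where falsity is needed: an atom is true exactly when it belongs to `H`, and
      -- consistency on atoms excludes it.
      exact fun h => hH.rel R ts ((hrel R ts hsym).1 h) hA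
    | neg A => exact hα _ (.negNeg A)
    | conj A B => exact hβ _ _ (.negConj A B)
    | disj A B => exact hα _ (.negDisj A B)
    | impl A B => exact hα _ (.negImpl A B)
    | all A => exact hδ _ (.negAll A)
    | ex A => exact hγ _ (.negEx A)

/-- Completeness of GS3, for sets of closed formulas with infinitely many fresh constants: if a
finite part is unsatisfiable, there is a proof. -/
theorem GS3.of_finite_unsat {Γ Δ : Set (Closed L)} (hΔ : Δ ⊆ Γ) (hfin : Δ.Finite)
    (hfresh : {c : L.Constants |
      ∀ A ∈ Γ, (⟨0, c⟩ : Σ k, L.Functions k) ∉ A.symbols}.Infinite)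
    (hunsat : ∀ (M : Type u) [Nonempty M] (I : L.Structure M),
      ¬ ∀ A ∈ Δ, A.Holds I Empty.elim) : GS3 Γ := by
  by_contra hΓ
  let c := hfresh.natEmbedding
  -- A countable infinite supply of fresh constants is split off so that `S` stays countable; `c 0`
  -- also makes the Herbrand universe nonempty.
  let C : Set L.Constants := range fun n => (c n).1
  have hC : C.Infinite :=
    infinite_range_of_injective (Subtype.val_injective.comp c.injective)
  let S : Set (Σ k, L.Functions k) := symbolsOf Δ ∪ (fun c => ⟨0, c⟩) '' C
  have hS : S.Countable :=
    (hfin.biUnion fun A _ => A.symbols_finite).countable.union ((countable_range _).image _)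
  obtain ⟨H, hΔH, hHS, hH⟩ := exists_hintikka hC (by rintro _ ⟨n, rfl⟩; exact (c n).2) hΓ hΔ hfin
    hS (fun A hA => (symbols_subset_symbolsOf hA).trans subset_union_left)
    fun c hc => .inr ⟨c, hc, rfl⟩
  have hd : (Constants.term (c 0).1 : L.Term Empty) ∈ termsOver S := by
    rintro s (rfl | hs)
    · exact .inr ⟨_, mem_range_self 0, rfl⟩
    · obtain ⟨i, -⟩ := mem_iUnion.1 hs
      exact i.elim0
  have : Nonempty (termsOver S) := ⟨⟨_, hd⟩⟩
  exact hunsat (termsOver S) (herbrand S H ⟨_, hd⟩) fun A hA => hH.holds hHS _ (hΔH hA)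

end Completeness

end FVTab

/-- Let `T` be a closed tableau rooted at `Γ`, with unifier `σ`, and suppose that `σΓ` (made ground
by `κ` where `σ` leaves free variables) is a set `Γ'` of closed formulas without Skolem symbols. If
infinitely many constants are fresh for `Γ'`, then the sequent `Γ' ⊢` has a proof in GS3. -/
theorem theorem1 {L : FirstOrder.Language.{u, v}} {V : Type w}
    (Γ : Set (FVTab.Fml (FVTab.withSkolem L) V 0)) (T : FVTab.Tableau Γ)
    (σ : V → (FVTab.withSkolem L).Term V) (hT : FVTab.ClosedTableau T σ)
    (κ : V → L.Constants) (Γ' : Set (FVTab.Closed L))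
    (hΓ' : FVTab.groundInstance σ κ '' Γ = FVTab.Closed.embed V '' Γ')
    (hfresh : {c : L.Constants |
      ∀ A ∈ Γ', (⟨0, c⟩ : Σ k, L.Functions k) ∉ A.symbols}.Infinite) :
    FVTab.GS3 Γ' := by
  obtain ⟨Δ, hΔ, hfin, hunsat⟩ := hT.exists_finite_unsat κ hΓ'
  exact .of_finite_unsat hΔ hfin hfresh hunsat
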